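/- Let $G_0$ be a group with finite subgroups $A,B\le G_0$, let $\varphi:A\to B$ be an isomorphism, and let $$G=G_0\ast_\varphi=\langle G_0,t \mid at=t\varphi(a)\ \text{for all } a\in A\rangle$$ be the associated HNN extension, with identity $e$. Let $X$ and $Y$ be sets of representatives of the left cosets of $A$ and of $B$ in $G_0$, both containing the identity $e_0$ of $G_0$. Every $g\in G$ has a unique normal form $$g=g_1t_1g_2t_2\cdots g_nt_ng_{n+1},$$ where $n\ge 0$, $g_{n+1}\in G_0$, $t_i\in\{t,t^{-1}\}$, $g_i\in X$ if $t_i=t$, $g_i\in Y$ if $t_i=t^{-1}$ ($1\le i\le n$), and there is no subword $te_0t^{-1}$ or $t^{-1}e_0t$. Put $|g|_t:=n$. Let $\mathcal B$ be the set of infinite words $g_1t_1g_2t_2\cdots$ in normal form, that is, $t_i\in\{t,t^{-1}\}$, $g_i\in X$ if $t_i=t$, $g_i\in Y$ if $t_i=t^{-1}$ ($i\ge 1$), and $t_i\ne t_{i-1}^{-1}$ whenever $i\ge 2$ and $g_i=e_0$; equip $\mathcal B$ with the $\sigma$-algebra generated by the coordinates. Let $\mu_0$ be a finitely supported probability measure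 on $G_0$ whose support generates $G_0$ as a semigroup, let $\alpha,p\in(0,1)$, and let $$\mu=\alpha\,\mu_0+(1-\alpha)\bigl(p\,\delta_t+(1-p)\,\delta_{t^{-1}}\bigr).$$ Let $(\zeta_i)_{i\ge 1}$ be i.i.d. random variables with distribution $\mu$, and let $X_0=e$, $X_n=\zeta_1\zeta_2\cdots\zeta_n$. Assume that the random walk $(X_n)_{n\ge 0}$ is transient, that is, $\sum_{n\ge 0}\mathbb P[X_n=e]<\infty$. Then: 1. For every $k\in\mathbb N$, the exit time $$\mathbf e_k:=\min\{m\in\mathbb N_0 \mid |X_n|_t\ge k \text{ for all } n\ge m\}$$ (with $\min\emptyset=\infty$) is almost surely finite. 2. There is a $\mathcal B$-valued random variable $X_\infty$ such that $(X_n)_{n\ge 0}$ converges to $X_\infty$ almost surely, in the sense that almost surely the length of the common prefix $X_n\wedge X_\infty$ tends to infinity as $n\to\infty$. Here, for $x=g_1't_1'\cdots g_k't_k'g_{k+1}'$ in normal form and $g_\infty=g_1t_1g_2t_2\cdots\in\mathcal B$, $x\wedge g_\infty:=g_1t_1\cdots g_lt_l$, where $l\in\{0,\dots,k\}$ is maximal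 with $g_i=g_i'$ and $t_i=t_i'$ for all $i\le l$. -/

import Mathlib

open MeasureTheory ProbabilityTheory Filter Topology
open scoped ENNReal

namespace HNNWalk

variable {G₀ : Type*} [Group G₀] {A B : Subgroup G₀}

/-- The HNN extension `⟨G₀, t | a t = t φ(a) for a ∈ A⟩`. Mathlib's `HNNExtension G H K ψ` imposes
`t h = ψ(h) t` for `h ∈ H`, so the present convention is the one of `ψ = φ⁻¹ : B ≃* A`;
see `of_mul_t` below. -/
abbrev HNN (φ : A ≃* B) : Type _ := HNNExtension G₀ B A φ.symm

theorem of_mul_t (φ : A ≃* B) (a : A) :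
    (HNNExtension.of (a : G₀) * HNNExtension.t : HNN φ) =
      HNNExtension.t * HNNExtension.of (φ a : G₀) := by
  simpa using HNNExtension.of_mul_t (φ := φ.symm) a

/-- The (countable, in the application) group carries the discrete σ-algebra. -/
instance (φ : A ≃* B) : MeasurableSpace (HNN φ) := ⊤

instance (φ : A ≃* B) : DiscreteMeasurableSpace (HNN φ) := ⟨fun _ => trivial⟩

/-- A choice of representatives `X` of the left cosets `gA` and `Y` of the left cosets `gB`, both
containing the identity. -/
structure CosetReps (A B : Subgroup G₀) where
  X : Set G₀
  Y : Set G₀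
  isComplement_X : Subgroup.IsComplement X (A : Set G₀)
  isComplement_Y : Subgroup.IsComplement Y (B : Set G₀)
  one_mem_X : (1 : G₀) ∈ X
  one_mem_Y : (1 : G₀) ∈ Y

/-- The representatives allowed in front of the letter `t ^ u`: `X` in front of `t` and `Y` in front
of `t⁻¹`. -/
def CosetReps.rep (d : CosetReps A B) (u : ℤˣ) : Set G₀ := if u = 1 then d.X else d.Y

/-- The words `g₁ t₁ g₂ t₂ ⋯ gₙ tₙ gₙ₊₁` in normal form. The pair `(g, u)` in `letters` stands for
`g t ^ u`, and `last` is the final element `gₙ₊₁` of `G₀`. -/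
@[ext]
structure NormalForm (d : CosetReps A B) where
  letters : List (G₀ × ℤˣ)
  last : G₀
  mem_rep : ∀ x ∈ letters, x.1 ∈ d.rep x.2
  no_cancel : letters.IsChain (fun x y => y.1 = 1 → y.2 ≠ -x.2)

/-- The group element represented by a normal form. -/
def NormalForm.eval (φ : A ≃* B) {d : CosetReps A B} (w : NormalForm d) : HNN φ :=
  (w.letters.map fun x => HNNExtension.of x.1 * HNNExtension.t ^ (x.2 : ℤ)).prod *
    HNNExtension.of w.last

open HNNExtension.NormalWord in
/-- Existence and uniqueness of the normal form. -/
theorem NormalForm.eval_bijective (φ : A ≃* B) (d : CosetReps A B) :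
    Function.Bijective (NormalForm.eval φ : NormalForm d → HNN φ) := by
  have hinv : ∀ (S : Set G₀) (H : Subgroup G₀), Subgroup.IsComplement S (H : Set G₀) →
      Subgroup.IsComplement (H : Set G₀) S⁻¹ := by
    intro S H h
    rw [Subgroup.isComplement_iff_existsUnique_inv_mul_mem] at h
    rw [Subgroup.isComplement_iff_existsUnique_mul_inv_mem]
    intro g
    obtain ⟨s, hs, hu⟩ := h g⁻¹
    refine ⟨⟨(s : G₀)⁻¹, by simp⟩, ?_, ?_⟩
    · have := H.inv_mem hs
      simpa using this
    · rintro ⟨y, hy⟩ hy'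
      have := hu ⟨y⁻¹, hy⟩ (by simpa using H.inv_mem hy')
      apply Subtype.ext
      simp [← this]
  let D : TransversalPair G₀ B A :=
    { set := fun u => (d.rep (-u))⁻¹
      compl := by
        intro u
        rcases Int.units_eq_one_or u with rfl | rfl
        · simpa [CosetReps.rep] using hinv _ _ d.isComplement_Y
        · simpa [CosetReps.rep] using hinv _ _ d.isComplement_X }
  have hone : ∀ u, (1 : G₀) ∈ d.rep u := by
    intro u
    unfold CosetReps.rep
    split_ifs
    · exact d.one_mem_X
    · exact d.one_mem_Y
  have hmem : ∀ (u : ℤˣ) (g : G₀), g⁻¹ ∈ d.rep (-u) →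
      (g ∈ HNNExtension.toSubgroup B A u ↔ g = 1) := by
    intro u g hg
    constructor
    · intro h
      have := (Subgroup.isComplement_iff_existsUnique_mul_inv_mem.1 (D.compl u) 1)
      have h1 := this.unique (y₁ := ⟨1, by simpa [D] using hone (-u)⟩) (y₂ := ⟨g, hg⟩)
        (by simp [one_mem]) (by simpa using h)
      simpa using (congrArg Subtype.val h1).symm
    · rintro rfl
      exact one_mem _
  have hune : ∀ u v : ℤˣ, u ≠ -v ↔ v = u := by
    intro u v
    rw [Int.units_ne_iff_eq_neg, neg_neg, eq_comm]
  let F : NormalForm d ≃ HNNExtension.NormalWord D :=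
    { toFun := fun w =>
        { head := w.last⁻¹
          toList := (w.letters.map fun x => (-x.2, x.1⁻¹)).reverse
          chain := by
            rw [List.isChain_reverse, List.isChain_map]
            refine w.no_cancel.imp_of_mem_imp ?_
            intro x y _ hy h h'
            have := (hmem (-y.2) y.1⁻¹ (by simpa using w.mem_rep y hy)).1 h'
            have h3 := h (by simpa using this)
            rw [hune] at h3
            simp [h3]
          mem_set := by
            intro u g h
            simp only [List.mem_reverse, List.mem_map, Prod.mk.injEq] at h
            obtain ⟨x, hx, rfl, rfl⟩ := h
            simpa [D] using w.mem_rep x hx }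
      invFun := fun v =>
        { letters := (v.toList.map fun x => (x.2⁻¹, -x.1)).reverse
          last := v.head⁻¹
          mem_rep := by
            intro x hx
            simp only [List.mem_reverse, List.mem_map] at hx
            obtain ⟨y, hy, rfl⟩ := hx
            exact v.mem_set y.1 y.2 hy
          no_cancel := by
            rw [List.isChain_reverse, List.isChain_map]
            refine v.chain.imp_of_mem_imp ?_
            intro x y hx _ h h'
            rw [hune]
            have := h (by rw [inv_eq_one.1 h']; exact one_mem _)
            simp [this] }
      left_inv := by
        intro w
        ext1 <;> simp [Function.comp_def]
      right_inv := by
        intro v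
        apply HNNExtension.NormalWord.ext <;> simp [Function.comp_def] }
  have hF : ∀ w : NormalForm d, w.eval φ = ((F w).prod φ.symm)⁻¹ := by
    intro w
    simp only [NormalForm.eval, HNNExtension.NormalWord.ReducedWord.prod, F, Equiv.coe_fn_mk,
      mul_inv_rev, map_inv, inv_inv, List.prod_inv_reverse, List.map_reverse, List.map_map,
      List.reverse_reverse]
    congr 2
    apply List.map_congr_left
    intro x _
    simp
  have : (NormalForm.eval φ : NormalForm d → HNN φ) =
      fun w => ((HNNExtension.NormalWord.equiv φ.symm D).symm (F w))⁻¹ := by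
    funext w
    exact hF w
  rw [this]
  exact (Equiv.inv (HNN φ)).bijective.comp
    ((HNNExtension.NormalWord.equiv φ.symm D).symm.bijective.comp F.bijective)

/-- The normal form of a group element. -/
noncomputable def normalForm (φ : A ≃* B) (d : CosetReps A B) : HNN φ ≃ NormalForm d :=
  (Equiv.ofBijective _ (NormalForm.eval_bijective φ d)).symm

/-- The `t`-length `|g|_t`: the number of letters `t^{±1}` in the normal form of `g`. -/
noncomputable def tLength (φ : A ≃* B) (d : CosetReps A B) (g : HNN φ) : ℕ :=
  (normalForm φ d g).letters.length

/-- The step distribution `μ = α μ₀ + (1 - α) (p δ_t + (1 - p) δ_{t⁻¹})`. -/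
noncomputable def stepLaw (φ : A ≃* B) (μ₀ : PMF G₀) (α p : ℝ) : Measure (HNN φ) :=
  ENNReal.ofReal α • (μ₀.map (HNNExtension.of : G₀ →* HNN φ)).toMeasure +
    ENNReal.ofReal (1 - α) •
      (ENNReal.ofReal p • Measure.dirac HNNExtension.t +
        ENNReal.ofReal (1 - p) • Measure.dirac HNNExtension.t⁻¹)

/-- The right random walk `X₀ = e`, `Xₙ = ζ₁ ζ₂ ⋯ ζₙ`; the increment `ζₙ₊₁` is `ζ n` here. -/
def walk {G Ω : Type*} [Group G] (ζ : ℕ → Ω → G) : ℕ → Ω → G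
  | 0, _ => 1
  | n + 1, ω => walk ζ n ω * ζ n ω

/-- Transience of a random walk started at the identity: the expected number of visits to the
identity, i.e. the Green function `∑ₙ p⁽ⁿ⁾(e, e)`, is finite. -/
def IsTransient {G Ω : Type*} [Group G] [MeasurableSpace Ω] (P : Measure Ω) (X : ℕ → Ω → G) :
    Prop :=
  ∑' n, P {ω | X n ω = 1} < ∞

/-- The exit time `e_k = min {m | |xₙ|_t ≥ k for all n ≥ m}` of a trajectory `x`
(`⊤` if there is no such `m`). -/
noncomputable def exitTime (φ : A ≃* B) (d : CosetReps A B) (x : ℕ → HNN φ) (k : ℕ) : ℕ∞ :=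
  ⨅ m ∈ {m : ℕ | ∀ n, m ≤ n → k ≤ tLength φ d (x n)}, (m : ℕ∞)

/-- The set `𝓑` of infinite words `g₁ t₁ g₂ t₂ ⋯` in normal form. The pair `w i = (g, u)` stands
for `g t ^ u`; the numbering starts at `i = 0`. -/
def Boundary (d : CosetReps A B) : Type _ :=
  {w : ℕ → G₀ × ℤˣ // (∀ i, (w i).1 ∈ d.rep (w i).2) ∧
    ∀ i, (w (i + 1)).1 = 1 → (w (i + 1)).2 ≠ -(w i).2}

/-- The trace on `𝓑` of the product σ-algebra on infinite words over the discrete alphabet, which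
is generated by the coordinates. -/
instance (d : CosetReps A B) : MeasurableSpace (Boundary d) :=
  ⨆ i : ℕ, MeasurableSpace.comap (fun w : Boundary d => w.1 i) ⊤

/-- The `t`-length of the longest common prefix `g₁ t₁ ⋯ g_l t_l` of a finite word (with the pairs
`(gᵢ, tᵢ)` listed in `l`) and an infinite word `w`. -/
noncomputable def commonPrefixLength {S : Type*} (l : List S) (w : ℕ → S) : ℕ :=
  sSup {i : ℕ | i ≤ l.length ∧ ∀ j < i, l[j]? = some (w j)}

/-- A trajectory converges to the infinite word `w` if the length of its common prefix with `w`
tends to infinity. -/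
def ConvergesTo (φ : A ≃* B) (d : CosetReps A B) (x : ℕ → HNN φ) (w : Boundary d) : Prop :=
  Tendsto (fun n => commonPrefixLength (normalForm φ d (x n)).letters w.1) atTop atTop

end HNNWalk

/-!
The walk takes place on the Bass–Serre tree: the letters of the normal form of `g` determine the
left coset `g G₀`, a vertex of the tree, and one step of the walk leaves this list of letters alone,
appends a letter to it or cancels its last letter (`prefixWord_mul_step`). Cancelling happens only
at group elements of the form `v k` with `k ∈ A ∪ B`, where `v` is the product of the letters; as
`A` and `B` are finite, an edge is crossed towards the root `G₀` only at finitely many group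
elements.

For any irreducible walk and any subgroup `H`, almost surely either every left coset of `H` is
visited finitely often or every one is visited infinitely often
(`IsIIDSteps.ae_frequently_mem_coset`). Indeed the number of visits to `H` satisfies a zero-one law,
because the walk starts afresh at each visit, and by irreducibility the starting point is irrelevant.
For `H = G₀` the second alternative is impossible: the walk would visit both `G₀` and `t G₀`
infinitely often, hence cross the edge between them infinitely often, hence visit some group element
infinitely often (`frequently_mem_of_frequently_cosets`), against transience.

So every vertex of the tree is visited finitely often. By induction on `k` the first `k` letters of
the normal form are eventually constant: once they are, the vertex that they describe is eventually
left for good, and then letter `k + 1` is present and cannot change any more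
(`eventually_getElem?_prefixWord`). This gives the finiteness of the exit times and the limit word.
-/

namespace HNNWalk

/-! ### Random walks on countable groups -/

section RandomWalk

theorem walk_add {G Ω : Type*} [Group G] (ζ : ℕ → Ω → G) (m n : ℕ) (ω : Ω) :
    walk ζ (m + n) ω = walk ζ m ω * walk (fun i => ζ (m + i)) n ω := by
  induction n with
  | zero => simp [walk]
  | succ n ih =>
    change walk ζ (m + n) ω * ζ (m + n) ω = _
    rw [ih, mul_assoc]
    rfl

/-- The walk as a function of the sequence of its increments, on the path space `ℕ → G`. -/
def pathWalk {G : Type*} [Group G] (n : ℕ) (z : ℕ → G) : G :=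
  walk (fun i (z : ℕ → G) => z i) n z

theorem pathWalk_apply {G Ω : Type*} [Group G] (ζ : ℕ → Ω → G) (n : ℕ) (ω : Ω) :
    pathWalk n (fun i => ζ i ω) = walk ζ n ω := by
  unfold pathWalk
  induction n with
  | zero => rfl
  | succ n ih => simp only [walk, ih]

/-- The σ-algebra generated by the first `m` increments. -/
abbrev past {G Ω : Type*} [MeasurableSpace G] (ζ : ℕ → Ω → G) (m : ℕ) : MeasurableSpace Ω :=
  ⨆ i ∈ Set.Iio m, MeasurableSpace.comap (ζ i) inferInstance

theorem past_mono {G Ω : Type*} [MeasurableSpace G] (ζ : ℕ → Ω → G) : Monotone (past ζ) :=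
  fun _ _ h => biSup_mono fun _ hi => lt_of_lt_of_le hi h

/-- The increments `ζ` are measurable, independent and identically distributed. -/
structure IsIIDSteps {G Ω : Type*} [MeasurableSpace G] [MeasurableSpace Ω] (P : Measure Ω)
    (ζ : ℕ → Ω → G) : Prop where
  meas : ∀ i, Measurable (ζ i)
  indep : iIndepFun ζ P
  map_eq : ∀ i, P.map (ζ i) = P.map (ζ 0)

theorem IsIIDSteps.past_le {G Ω : Type*} [MeasurableSpace G] {mΩ : MeasurableSpace Ω}
    {P : Measure Ω} {ζ : ℕ → Ω → G} (h : IsIIDSteps P ζ) (m : ℕ) : past ζ m ≤ mΩ :=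
  iSup₂_le fun i _ => (h.meas i).comap_le

/-- The Markov property: the increments after time `m` are independent of the past and have the same
joint law as the whole sequence of increments. -/
theorem IsIIDSteps.measure_inter_shift {G Ω : Type*} [MeasurableSpace G] [MeasurableSpace Ω]
    {P : Measure Ω} {ζ : ℕ → Ω → G} (h : IsIIDSteps P ζ) (m : ℕ) {S : Set Ω}
    (hS : MeasurableSet[past ζ m] S) {W : Set (ℕ → G)} (hW : MeasurableSet W) :
    P (S ∩ {ω | (fun i => ζ (m + i) ω) ∈ W}) = P S * P {ω | (fun i => ζ i ω) ∈ W} := by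
  have hI := indep_iSup_of_disjoint (fun i => (h.meas i).comap_le) h.indep
    (S := Set.Iio m) (T := Set.Ici m) (Set.Iio_disjoint_Ici le_rfl)
  have hmeas : MeasurableSet[⨆ i ∈ Set.Ici m, MeasurableSpace.comap (ζ i) inferInstance]
      {ω | (fun i => ζ (m + i) ω) ∈ W} := by
    refine (@measurable_pi_iff Ω ℕ (fun _ => G)
      (⨆ i ∈ Set.Ici m, MeasurableSpace.comap (ζ i) inferInstance) _
      (fun ω i => ζ (m + i) ω)).2 (fun i => ?_) hW
    exact Measurable.of_comap_le (le_biSup (fun i => MeasurableSpace.comap (ζ i) inferInstance)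
      (Set.mem_Ici.2 (Nat.le_add_right m i)))
  rw [Indep_iff] at hI
  rw [hI _ _ hS hmeas]
  congr 1
  have e1 := h.indep.map_fun_eq_infinitePi_map h.meas
  have e2 := (h.indep.precomp (g := fun i => m + i)
    (add_right_injective m)).map_fun_eq_infinitePi_map fun i => h.meas (m + i)
  have e : P.map (fun ω i => ζ (m + i) ω) = P.map (fun ω i => ζ i ω) := by
    refine e2.trans (Eq.trans ?_ e1.symm)
    congr 1
    funext i
    exact (h.map_eq (m + i)).trans (h.map_eq i).symm
  have := congrArg (fun Q => Q W) e
  rwa [Measure.map_apply (measurable_pi_lambda _ fun i => h.meas (m + i)) hW,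
    Measure.map_apply (measurable_pi_lambda _ h.meas) hW] at this

variable {G Ω : Type*} [Group G] [Countable G] [MeasurableSpace G] [DiscreteMeasurableSpace G]

theorem measurable_pathWalk (n : ℕ) : Measurable (pathWalk n : (ℕ → G) → G) := by
  induction n with
  | zero => exact measurable_const
  | succ n ih => exact ih.mul (measurable_pi_apply n)

theorem measurable_walk_past (ζ : ℕ → Ω → G) (m : ℕ) : Measurable[past ζ m] (walk ζ m) := by
  induction m with
  | zero => exact measurable_const
  | succ m ih =>
    have h1 : Measurable[past ζ (m + 1)] (walk ζ m) := ih.mono (past_mono ζ m.le_succ) le_rfl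
    have h2 : Measurable[past ζ (m + 1)] (ζ m) :=
      Measurable.of_comap_le (le_biSup (fun i => MeasurableSpace.comap (ζ i) inferInstance)
        (Set.mem_Iio.2 m.lt_succ_self))
    exact h1.mul h2

variable [MeasurableSpace Ω] {P : Measure Ω} {ζ : ℕ → Ω → G}

theorem IsIIDSteps.measurable_walk (h : IsIIDSteps P ζ) (n : ℕ) : Measurable (walk ζ n) :=
  (measurable_walk_past ζ n).mono (h.past_le n) le_rfl

/-- If the walk may be at `x` at time `m`, and from then on its increments almost surely form a
sequence in `W`, then the increments of the walk itself almost surely form a sequence in `W`. -/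
theorem IsIIDSteps.ae_mem_of_shift (h : IsIIDSteps P ζ) {m : ℕ} {x : G}
    (hx : P {ω | walk ζ m ω = x} ≠ 0) {W : Set (ℕ → G)} (hW : MeasurableSet W)
    (hae : ∀ᵐ ω ∂P, walk ζ m ω = x → (fun i => ζ (m + i) ω) ∈ W) :
    ∀ᵐ ω ∂P, (fun i => ζ i ω) ∈ W := by
  have h1 := h.measure_inter_shift m (S := {ω | walk ζ m ω = x})
    (measurable_walk_past ζ m (MeasurableSet.singleton x)) hW.compl
  have h2 : P ({ω | walk ζ m ω = x} ∩ {ω | (fun i => ζ (m + i) ω) ∈ Wᶜ}) = 0 := by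
    refine measure_mono_null ?_ (ae_iff.1 hae)
    rintro ω ⟨h1, h2⟩ h3
    exact h2 (h3 h1)
  rw [h2, eq_comm, mul_eq_zero] at h1
  exact ae_iff.2 (h1.resolve_left hx)

theorem IsIIDSteps.measure_walk_mul_le (h : IsIIDSteps P ζ) (m n : ℕ) (x y : G) :
    P {ω | walk ζ m ω = x} * P {ω | walk ζ n ω = y} ≤ P {ω | walk ζ (m + n) ω = x * y} := by
  have h1 := h.measure_inter_shift m (S := {ω | walk ζ m ω = x})
    (measurable_walk_past ζ m (MeasurableSet.singleton x))
    (measurable_pathWalk n (MeasurableSet.singleton y))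
  simp only [Set.mem_preimage, pathWalk_apply, Set.mem_singleton_iff] at h1
  rw [← h1]
  refine measure_mono ?_
  rintro ω ⟨hx, hy⟩
  rw [Set.mem_ofPred_eq] at hx hy
  rw [Set.mem_ofPred_eq, walk_add, hx, hy]

/-- Every group element is reached by the walk with positive probability. -/
def IsIrreducible {G Ω : Type*} [Group G] [MeasurableSpace Ω] (P : Measure Ω)
    (ζ : ℕ → Ω → G) : Prop :=
  ∀ x, ∃ n, P {ω | walk ζ n ω = x} ≠ 0

/-- A transient irreducible walk visits every group element only finitely often. -/
theorem IsIIDSteps.ae_eventually_walk_ne (h : IsIIDSteps P ζ) (hirr : IsIrreducible P ζ)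
    (htrans : IsTransient P (walk ζ)) : ∀ᵐ ω ∂P, ∀ x, ∀ᶠ n in atTop, walk ζ n ω ≠ x := by
  rw [ae_all_iff]
  intro x
  obtain ⟨m, hm⟩ := hirr x⁻¹
  refine ae_eventually_notMem (s := fun n => {ω | walk ζ n ω = x}) fun htop => ?_
  have h1 : (∑' n, P {ω | walk ζ n ω = x}) * P {ω | walk ζ m ω = x⁻¹}
      ≤ ∑' n, P {ω | walk ζ n ω = 1} := by
    rw [← ENNReal.tsum_mul_right]
    calc _ ≤ ∑' n, P {ω | walk ζ (n + m) ω = 1} := by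
          refine ENNReal.tsum_le_tsum fun n => ?_
          simpa using h.measure_walk_mul_le n m x x⁻¹
      _ ≤ _ := ENNReal.tsum_comp_le_tsum_of_injective (add_left_injective m) _
  rw [htop, ENNReal.top_mul hm] at h1
  exact absurd htrans (by simp [IsTransient, top_le_iff.1 h1])

/-- The increment sequences for which the walk started at `x` visits `s` infinitely often. -/
def infinitelyOften {G : Type*} [Group G] (x : G) (s : Set G) : Set (ℕ → G) :=
  {z | ∃ᶠ n in atTop, x * pathWalk n z ∈ s}

theorem measurableSet_infinitelyOften (x : G) (s : Set G) :
    MeasurableSet (infinitelyOften x s) := by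
  have : infinitelyOften x s = ⋂ a, ⋃ b, ⋃ (_ : a ≤ b), {z | x * pathWalk b z ∈ s} := by
    ext z
    simp [infinitelyOften, frequently_atTop]
  rw [this]
  refine .iInter fun a => .iUnion fun b => .iUnion fun _ => ?_
  exact measurable_pathWalk b (MeasurableSet.of_discrete (s := {y | x * y ∈ s}))

theorem mem_infinitelyOften {G Ω : Type*} [Group G] (ζ : ℕ → Ω → G) (x : G) (s : Set G) (ω : Ω) :
    (fun i => ζ i ω) ∈ infinitelyOften x s ↔ ∃ᶠ n in atTop, x * walk ζ n ω ∈ s := by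
  simp [infinitelyOften, pathWalk_apply]

/-- Visiting a set infinitely often does not depend on the first `m` steps. -/
theorem mem_infinitelyOften_shift {G Ω : Type*} [Group G] (ζ : ℕ → Ω → G) (m : ℕ) (x : G)
    (s : Set G) (ω : Ω) :
    (fun i => ζ (m + i) ω) ∈ infinitelyOften (x * walk ζ m ω) s ↔
      ∃ᶠ n in atTop, x * walk ζ n ω ∈ s := by
  rw [mem_infinitelyOften (fun i => ζ (m + i))]
  simp only [mul_assoc, ← walk_add]
  conv_rhs => rw [← map_add_atTop_eq_nat m, frequently_map]
  simp only [add_comm m]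

/-- A subgroup is visited infinitely often with probability `0` or `1`: by the Markov property at
the first visit after time `n`, the probability `c` of infinitely many visits is `c` times the
probability of a visit after time `n`. -/
theorem IsIIDSteps.ae_frequently_mem_subgroup [IsProbabilityMeasure P] (h : IsIIDSteps P ζ)
    (H : Subgroup G) :
    (∀ᵐ ω ∂P, ¬ ∃ᶠ n in atTop, walk ζ n ω ∈ H) ∨ ∀ᵐ ω ∂P, ∃ᶠ n in atTop, walk ζ n ω ∈ H := by
  rw [or_iff_not_imp_left]
  intro hne
  set E : Set Ω := {ω | ∃ᶠ n in atTop, walk ζ n ω ∈ H} with hE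
  have hEio : E = {ω | (fun i => ζ i ω) ∈ infinitelyOften 1 (H : Set G)} := by
    ext ω
    simp [hE, infinitelyOften, pathWalk_apply]
  have hEmeas : MeasurableSet E := by
    rw [hEio]
    exact measurable_pi_lambda _ h.meas (measurableSet_infinitelyOften _ _)
  have hE0 : P E ≠ 0 := fun h0 => hne (measure_eq_zero_iff_ae_notMem.1 h0)
  have hvisit : ∀ n, ∀ᵐ ω ∂P, ∃ j, walk ζ (n + j) ω ∈ H := by
    intro n
    set S : ℕ → Set Ω := fun j => {ω | walk ζ (n + j) ω ∈ H} with hS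
    have hSpast : ∀ j, MeasurableSet[past ζ (n + j)] (disjointed S j) := by
      intro j
      have hS' : ∀ i ≤ j, MeasurableSet[past ζ (n + j)] (S i) := fun i hi =>
        past_mono ζ (Nat.add_le_add_left hi n) _
          (measurable_walk_past ζ (n + i) (MeasurableSet.of_discrete (s := (H : Set G))))
      rw [disjointed_eq_inter_compl]
      exact (hS' j le_rfl).inter (.iInter fun i => .iInter fun hi => (hS' i hi.le).compl)
    have hSmeas : ∀ j, MeasurableSet (disjointed S j) := fun j => h.past_le _ _ (hSpast j)
    have hterm : ∀ j, P (disjointed S j ∩ E) = P (disjointed S j) * P E := by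
      intro j
      rw [hEio, ← h.measure_inter_shift (n + j) (hSpast j) (measurableSet_infinitelyOften _ _),
        ← hEio]
      congr 1
      ext ω
      refine and_congr_right fun hω => ?_
      have hω : walk ζ (n + j) ω ∈ H := disjointed_subset S j hω
      rw [hE, Set.mem_ofPred_eq, Set.mem_ofPred_eq,
        mem_infinitelyOften (fun i => ζ (n + j + i))]
      conv_lhs => rw [← map_add_atTop_eq_nat (n + j), frequently_map]
      simp only [add_comm _ (n + j), walk_add ζ (n + j), H.mul_mem_cancel_left hω, one_mul,
        SetLike.mem_coe]
    have hsub : E ⊆ ⋃ j, S j := by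
      intro ω hω
      obtain ⟨m, hm, hmH⟩ := frequently_atTop.1 hω n
      exact Set.mem_iUnion.2 ⟨m - n, by simpa [hS, Nat.add_sub_cancel' hm] using hmH⟩
    have hsum : P E = P (⋃ j, S j) * P E := by
      calc P E = P (⋃ j, disjointed S j ∩ E) := by
            rw [← Set.iUnion_inter, iUnion_disjointed, Set.inter_eq_right.2 hsub]
        _ = ∑' j, P (disjointed S j ∩ E) :=
            measure_iUnion (fun i j hij => (disjoint_disjointed S hij).mono
              Set.inter_subset_left Set.inter_subset_left) fun j => (hSmeas j).inter hEmeas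
        _ = (∑' j, P (disjointed S j)) * P E := by simp_rw [hterm, ENNReal.tsum_mul_right]
        _ = P (⋃ j, S j) * P E := by
            rw [← measure_iUnion (disjoint_disjointed S) hSmeas, iUnion_disjointed]
    have hone : P (⋃ j, S j) = 1 := by
      have := (ENNReal.mul_eq_right hE0 (measure_ne_top P E)).1 hsum.symm
      exact this
    have hmeas : MeasurableSet (⋃ j, S j) := .iUnion fun j =>
      h.measurable_walk (n + j) (MeasurableSet.of_discrete (s := (H : Set G)))
    filter_upwards [(mem_ae_iff_prob_eq_one hmeas).2 hone] with ω hω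
    simpa [hS] using hω
  filter_upwards [ae_all_iff.2 hvisit] with ω hω
  refine frequently_atTop.2 fun n => ?_
  obtain ⟨j, hj⟩ := hω n
  exact ⟨n + j, n.le_add_right j, hj⟩

/-- For an irreducible walk, either all left cosets of a subgroup are visited finitely often, or all
of them are visited infinitely often. The coset `x⁻¹ H` is visited by the walk when `H` is visited
by the walk started at `x`. -/
theorem IsIIDSteps.ae_frequently_mem_coset [IsProbabilityMeasure P] (h : IsIIDSteps P ζ)
    (hirr : IsIrreducible P ζ) (H : Subgroup G) :
    (∀ᵐ ω ∂P, ∀ x, ∀ᶠ n in atTop, x * walk ζ n ω ∉ H) ∨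
      ∀ᵐ ω ∂P, ∀ x, ∃ᶠ n in atTop, x * walk ζ n ω ∈ H := by
  refine (h.ae_frequently_mem_subgroup H).imp (fun h0 => ?_) (fun h1 => ?_) <;>
    refine ae_all_iff.2 fun x => ?_ <;> obtain ⟨m, hm⟩ := hirr x
  · have := h.ae_mem_of_shift hm (measurableSet_infinitelyOften x (H : Set G)).compl ?_
    · filter_upwards [this] with ω hω
      rwa [Set.mem_compl_iff, mem_infinitelyOften, not_frequently] at hω
    · filter_upwards [h0] with ω hω hx
      rw [Set.mem_compl_iff, ← hx, ← one_mul (walk ζ m ω), mem_infinitelyOften_shift]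
      simpa using hω
  · have := h.ae_mem_of_shift hm (measurableSet_infinitelyOften x (H : Set G)) ?_
    · filter_upwards [this] with ω hω
      rwa [mem_infinitelyOften] at hω
    · filter_upwards [h1] with ω hω hx
      rw [← hx, ← one_mul (walk ζ m ω), mem_infinitelyOften_shift]
      simpa using hω

end RandomWalk

/-! ### Normal forms along a trajectory -/

section Tree

variable {G₀ : Type*} [Group G₀] {A B : Subgroup G₀}

theorem eval_normalForm (φ : A ≃* B) (d : CosetReps A B) (g : HNN φ) :
    (normalForm φ d g).eval φ = g :=
  (Equiv.ofBijective _ (NormalForm.eval_bijective φ d)).apply_symm_apply g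

theorem normalForm_eval (φ : A ≃* B) (d : CosetReps A B) (w : NormalForm d) :
    normalForm φ d (w.eval φ) = w :=
  (Equiv.ofBijective _ (NormalForm.eval_bijective φ d)).symm_apply_apply w

theorem normalForm_eq_iff (φ : A ≃* B) {d : CosetReps A B} {g : HNN φ} {w : NormalForm d} :
    normalForm φ d g = w ↔ g = w.eval φ :=
  ⟨fun h => h ▸ (eval_normalForm φ d g).symm, fun h => h ▸ normalForm_eval φ d w⟩

/-- The letters `g₁ t₁ ⋯ gₙ tₙ` of the normal form of `g`. They determine the left coset `g G₀`, a
vertex of the Bass–Serre tree, and list the edges of the geodesic from the vertex `G₀` to it. -/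
noncomputable def prefixWord (φ : A ≃* B) (d : CosetReps A B) (g : HNN φ) : List (G₀ × ℤˣ) :=
  (normalForm φ d g).letters

theorem prefixWord_mul_of (φ : A ≃* B) (d : CosetReps A B) (g : HNN φ) (h : G₀) :
    prefixWord φ d (g * HNNExtension.of h) = prefixWord φ d g := by
  have : normalForm φ d (g * HNNExtension.of h) =
      { normalForm φ d g with last := (normalForm φ d g).last * h } := by
    rw [normalForm_eq_iff]
    conv_lhs => rw [← eval_normalForm φ d g]
    simp [NormalForm.eval, mul_assoc]
  simp [prefixWord, this]

theorem exists_eq_mul_of (φ : A ≃* B) (d : CosetReps A B) {g g' : HNN φ}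
    (h : prefixWord φ d g = prefixWord φ d g') : ∃ k : G₀, g' = g * HNNExtension.of k := by
  refine ⟨(normalForm φ d g).last⁻¹ * (normalForm φ d g').last, ?_⟩
  unfold prefixWord at h
  calc g' = (normalForm φ d g').eval φ := (eval_normalForm φ d g').symm
    _ = (normalForm φ d g).eval φ *
        HNNExtension.of ((normalForm φ d g).last⁻¹ * (normalForm φ d g').last) := by
      simp [NormalForm.eval, h, mul_assoc]
    _ = _ := by rw [eval_normalForm]

theorem prefixWord_one (φ : A ≃* B) (d : CosetReps A B) : prefixWord φ d 1 = [] := by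
  have : normalForm φ d 1 = ⟨[], 1, by simp, by simp⟩ := by
    rw [normalForm_eq_iff]; simp [NormalForm.eval]
  simp [prefixWord, this]

theorem prefixWord_t (φ : A ≃* B) (d : CosetReps A B) :
    prefixWord φ d HNNExtension.t = [(1, 1)] := by
  have : normalForm φ d HNNExtension.t =
      ⟨[(1, 1)], 1, by simp [CosetReps.rep, d.one_mem_X], by simp⟩ := by
    rw [normalForm_eq_iff]; simp [NormalForm.eval]
  simp [prefixWord, this]

/-- Moving a letter `t ^ u` to the left through an element of `G₀` turns that element into a coset
representative, at the cost of an element of the associated subgroups. -/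
theorem exists_rep_mul (φ : A ≃* B) (d : CosetReps A B) (u : ℤˣ) (h : G₀) :
    ∃ x ∈ d.rep u, ∃ a k : G₀, (a ∈ A ∨ a ∈ B) ∧ h = x * a ∧
      (HNNExtension.of a * HNNExtension.t ^ (u : ℤ) : HNN φ) =
        HNNExtension.t ^ (u : ℤ) * HNNExtension.of k := by
  rcases Int.units_eq_one_or u with rfl | rfl
  · obtain ⟨⟨x, a⟩, hxa⟩ := d.isComplement_X.2 h
    exact ⟨x, by simp [CosetReps.rep], a, φ a, Or.inl a.2, hxa.symm,
      by simpa using of_mul_t φ a⟩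
  · obtain ⟨⟨x, b⟩, hxb⟩ := d.isComplement_Y.2 h
    refine ⟨x, by simp [CosetReps.rep], b, φ.symm b, Or.inr b.2, hxb.symm, ?_⟩
    have := of_mul_t φ (φ.symm b)
    rw [φ.apply_symm_apply] at this
    rw [Units.val_neg, Units.val_one, zpow_neg, zpow_one, eq_inv_mul_iff_mul_eq, ← mul_assoc,
      ← this, mul_inv_cancel_right]

/-- Multiplication by `t ^ u` appends a letter to the normal form, or cancels its last letter. The
latter is possible only if the element of `G₀` at the end of the normal form lies in one of the
associated subgroups. -/
theorem prefixWord_mul_t (φ : A ≃* B) (d : CosetReps A B) (g : HNN φ) (u : ℤˣ) :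
    (∃ x, prefixWord φ d (g * HNNExtension.t ^ (u : ℤ)) = prefixWord φ d g ++ [x]) ∨
      ∃ x, prefixWord φ d g = prefixWord φ d (g * HNNExtension.t ^ (u : ℤ)) ++ [x] ∧
        ((normalForm φ d g).last ∈ A ∨ (normalForm φ d g).last ∈ B) := by
  obtain ⟨x, hx, a, k, hAB, hlast, hak⟩ := exists_rep_mul φ d u (normalForm φ d g).last
  set w := normalForm φ d g with hw
  have hg : g = w.eval φ := (eval_normalForm φ d g).symm
  by_cases hc : ∃ l y, w.letters = l ++ [(y, -u)] ∧ x = 1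
  · obtain ⟨l, y, hl, rfl⟩ := hc
    right
    have hwr := w.mem_rep
    have hwc := w.no_cancel
    rw [hl] at hwr hwc
    have : normalForm φ d (g * HNNExtension.t ^ (u : ℤ)) =
        ⟨l, y * k, fun z hz => hwr z (by simp [hz]), hwc.left_of_append⟩ := by
      rw [normalForm_eq_iff, hg]
      simp only [NormalForm.eval, hl, hlast, one_mul, mul_assoc, hak, List.map_append,
        List.prod_append, List.map_cons, List.map_nil, List.prod_cons, List.prod_nil, map_mul,
        mul_one, Units.val_neg, zpow_neg, inv_mul_cancel_left]
    refine ⟨(y, -u), ?_, ?_⟩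
    · rw [prefixWord, prefixWord, this, ← hw, hl]
    · rwa [hlast, one_mul]
  · left
    have : normalForm φ d (g * HNNExtension.t ^ (u : ℤ)) =
        ⟨w.letters ++ [(x, u)], k, by
          intro z hz
          rcases List.mem_append.1 hz with hz | hz
          · exact w.mem_rep z hz
          · rw [List.mem_singleton.1 hz]
            exact hx, by
          refine List.isChain_append.2 ⟨w.no_cancel, by simp, ?_⟩
          rintro ⟨y, v⟩ hy z hz h1 hv
          obtain ⟨l, hl⟩ := List.getLast?_eq_some_iff.1 hy
          obtain rfl : (x, u) = z := by simpa using hz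
          exact hc ⟨l, y, by rw [hl, show u = -v from hv, neg_neg], h1⟩⟩ := by
      rw [normalForm_eq_iff, hg]
      simp only [NormalForm.eval, hlast, mul_assoc, hak, List.map_append,
        List.prod_append, List.map_cons, List.map_nil, List.prod_cons, List.prod_nil, map_mul,
        mul_one]
    exact ⟨(x, u), by rw [prefixWord, prefixWord, this]⟩

/-- A step of the random walk: an element of `G₀`, `t` or `t⁻¹`. -/
def IsStep (φ : A ≃* B) (s : HNN φ) : Prop :=
  (∃ h : G₀, s = HNNExtension.of h) ∨ ∃ u : ℤˣ, s = HNNExtension.t ^ (u : ℤ)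

/-- A step moves the prefix word to itself or to a neighbour in the tree of words. -/
theorem prefixWord_mul_step (φ : A ≃* B) (d : CosetReps A B) (g : HNN φ) {s : HNN φ}
    (hs : IsStep φ s) :
    prefixWord φ d (g * s) = prefixWord φ d g ∨
      (∃ x, prefixWord φ d (g * s) = prefixWord φ d g ++ [x]) ∨
      ∃ x, prefixWord φ d g = prefixWord φ d (g * s) ++ [x] ∧
        ((normalForm φ d g).last ∈ A ∨ (normalForm φ d g).last ∈ B) := by
  obtain ⟨h, rfl⟩ | ⟨u, rfl⟩ := hs
  · exact Or.inl (prefixWord_mul_of φ d g h)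
  · exact Or.inr (prefixWord_mul_t φ d g u)

theorem prefixWord_eq_nil (φ : A ≃* B) (d : CosetReps A B) {g : HNN φ}
    (hg : g ∈ (HNNExtension.of : G₀ →* HNN φ).range) : prefixWord φ d g = [] := by
  obtain ⟨h, rfl⟩ := hg
  simpa [prefixWord_one] using prefixWord_mul_of φ d 1 h

theorem prefixWord_eq_t (φ : A ≃* B) (d : CosetReps A B) {g : HNN φ}
    (hg : HNNExtension.t⁻¹ * g ∈ (HNNExtension.of : G₀ →* HNN φ).range) :
    prefixWord φ d g = [(1, 1)] := by
  obtain ⟨h, hh⟩ := hg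
  rw [eq_inv_mul_iff_mul_eq] at hh
  rw [← hh, prefixWord_mul_of, prefixWord_t]

/-- A trajectory that visits both `G₀` and `t G₀` infinitely often visits infinitely often the
finite set `t (A ∪ B)`, because it has to cross the edge between these two vertices. -/
theorem frequently_mem_of_frequently_cosets [Finite A] [Finite B] (φ : A ≃* B)
    (d : CosetReps A B) {x : ℕ → HNN φ} (hx : ∀ n, ∃ s, IsStep φ s ∧ x (n + 1) = x n * s)
    (h0 : ∃ᶠ n in atTop, x n ∈ (HNNExtension.of : G₀ →* HNN φ).range)
    (ht : ∃ᶠ n in atTop, HNNExtension.t⁻¹ * x n ∈ (HNNExtension.of : G₀ →* HNN φ).range) :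
    ∃ g, ∃ᶠ n in atTop, x n = g := by
  set F : Set (HNN φ) := (fun h : G₀ => HNNExtension.t * HNNExtension.of h) '' (A ∪ B : Set G₀)
  have hF : F.Finite := by
    have hA : (A : Set G₀).Finite := Set.toFinite _
    have hB : (B : Set G₀).Finite := Set.toFinite _
    exact (hA.union hB).image _
  have hfreq : ∃ᶠ n in atTop, x n ∈ F := by
    refine frequently_atTop.2 fun N => ?_
    obtain ⟨a, haN, ha⟩ := frequently_atTop.1 ht N
    obtain ⟨b, hba, hb⟩ := frequently_atTop.1 h0 a
    have ha' := prefixWord_eq_t φ d ha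
    have hb' := prefixWord_eq_nil φ d hb
    -- The prefix word starts with the letter `t` at time `a` but not at time `b`; consider the step
    -- at which it loses that letter.
    have key : ∀ c, a ≤ c → (prefixWord φ d (x c)).head? ≠ some (1, 1) →
        ∃ n, a ≤ n ∧ x n ∈ F := by
      intro c hc
      induction c, hc using Nat.le_induction with
      | base => intro h; simp [ha'] at h
      | succ c hac ih =>
        intro hne
        by_cases hcc : (prefixWord φ d (x c)).head? = some (1, 1)
        · obtain ⟨s, hs, hxs⟩ := hx c
          rw [hxs] at hne
          rcases prefixWord_mul_step φ d (x c) hs with h | ⟨y, h⟩ | ⟨y, h, hAB⟩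
          · exact absurd (h ▸ hcc) hne
          · rw [h, List.head?_append, hcc] at hne
            exact absurd rfl hne
          · rw [h, List.head?_append] at hcc
            cases hp : prefixWord φ d (x c * s) with
            | cons z l => rw [hp] at hcc hne; exact absurd (by simpa using hcc) hne
            | nil =>
              rw [hp] at hcc h
              refine ⟨c, hac, (normalForm φ d (x c)).last, hAB, ?_⟩
              have hy : y = (1, 1) := by simpa using hcc
              have hl : (normalForm φ d (x c)).letters = [(1, 1)] := by
                rw [← hy]; exact h
              conv_rhs => rw [← eval_normalForm φ d (x c)]
              simp [NormalForm.eval, hl]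
        · exact ih hcc
    obtain ⟨n, hn, hnF⟩ := key b hba (by simp [hb'])
    exact ⟨n, haN.trans hn, hnF⟩
  by_contra! hcon
  refine hfreq ?_
  have := (hF.eventually_all (l := atTop) (p := fun g n => x n ≠ g)).2 fun g _ => hcon g
  filter_upwards [this] with n hn hnF
  exact hn _ hnF rfl

/-- A trajectory that visits every vertex finitely often has prefix words whose initial segments
stabilise: once the first `k` letters are constant, the vertex which they describe is eventually
left for good, and then a letter in position `k` can no longer change. -/
theorem eventually_getElem?_prefixWord (φ : A ≃* B) (d : CosetReps A B) {x : ℕ → HNN φ}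
    (hx : ∀ n, ∃ s, IsStep φ s ∧ x (n + 1) = x n * s)
    (hfin : ∀ g, ∀ᶠ n in atTop, g * x n ∉ (HNNExtension.of : G₀ →* HNN φ).range) (i : ℕ) :
    ∃ s, ∀ᶠ n in atTop, (prefixWord φ d (x n))[i]? = some s := by
  have hleave : ∀ l, ∀ᶠ n in atTop, prefixWord φ d (x n) ≠ l := by
    intro l
    by_cases hl : ∃ m, prefixWord φ d (x m) = l
    · obtain ⟨m, rfl⟩ := hl
      filter_upwards [hfin (x m)⁻¹] with n hn heq
      obtain ⟨k, hk⟩ := exists_eq_mul_of φ d heq.symm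
      exact hn ⟨k, by rw [hk, inv_mul_cancel_left]⟩
    · exact Eventually.of_forall fun n hn => hl ⟨n, hn⟩
  have key : ∀ k, ∃ l : List (G₀ × ℤˣ), l.length = k ∧
      ∀ᶠ n in atTop, l <+: prefixWord φ d (x n) := by
    intro k
    induction k with
    | zero => exact ⟨[], rfl, by simp⟩
    | succ k ih =>
      obtain ⟨l, hlk, hl⟩ := ih
      obtain ⟨N, hN⟩ := eventually_atTop.1 (hl.and (hleave l))
      have hlong : ∀ n, N ≤ n → k + 1 ≤ (prefixWord φ d (x n)).length := by
        intro n hn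
        obtain ⟨h1, h2⟩ := hN n hn
        by_contra hlt
        exact h2 (h1.eq_of_length_le (by omega)).symm
      refine ⟨(prefixWord φ d (x N)).take (k + 1), by simpa using hlong N le_rfl, ?_⟩
      filter_upwards [eventually_ge_atTop N] with n hn
      have htake : (prefixWord φ d (x n)).take (k + 1) = (prefixWord φ d (x N)).take (k + 1) := by
        induction n, hn using Nat.le_induction with
        | base => rfl
        | succ n hn ih =>
          rw [← ih]
          obtain ⟨s, hs, hxs⟩ := hx n
          have h1 := hlong n hn
          have h2 := hlong (n + 1) (by omega)
          rw [hxs] at h2 ⊢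
          rcases prefixWord_mul_step φ d (x n) hs with h | ⟨y, h⟩ | ⟨y, h, -⟩
          · rw [h]
          · rw [h, List.take_append_of_le_length h1]
          · rw [h, List.take_append_of_le_length h2]
      rw [← htake]
      exact List.take_prefix _ _
  obtain ⟨l, hlk, hl⟩ := key (i + 1)
  refine ⟨l[i], ?_⟩
  filter_upwards [hl] with n hn
  obtain ⟨r, hr⟩ := hn
  rw [← hr, List.getElem?_append_left (by omega), List.getElem?_eq_getElem]

end Tree

/-! ### Convergence to an infinite word -/

section Limit

variable {G₀ : Type*} [Group G₀] {A B : Subgroup G₀}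

/-- The word `t t t ⋯`. -/
def Boundary.const (d : CosetReps A B) : Boundary d :=
  ⟨fun _ => (1, 1), fun _ => by simpa [CosetReps.rep] using d.one_mem_X, fun _ _ =>
    show (1 : ℤˣ) ≠ -1 by decide⟩

/-- Every letter of the prefix word is eventually constant along the trajectory. -/
def LettersStabilise (φ : A ≃* B) (d : CosetReps A B) (x : ℕ → HNN φ) : Prop :=
  ∀ i : ℕ, ∃ s, ∀ᶠ n in atTop, (prefixWord φ d (x n))[i]? = some s

/-- The infinite word formed by the eventual letters. -/
noncomputable def LettersStabilise.limit {φ : A ≃* B} {d : CosetReps A B} {x : ℕ → HNN φ}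
    (h : LettersStabilise φ d x) : Boundary d :=
  ⟨fun i => (h i).choose, by
    intro i
    obtain ⟨n, hn⟩ := (h i).choose_spec.exists
    exact (normalForm φ d (x n)).mem_rep _ (List.mem_of_getElem? hn), by
    intro i
    obtain ⟨n, hn, hn'⟩ := ((h i).choose_spec.and (h (i + 1)).choose_spec).exists
    obtain ⟨hi, hi'⟩ := List.getElem?_eq_some_iff.1 hn
    obtain ⟨hj, hj'⟩ := List.getElem?_eq_some_iff.1 hn'
    have hc : (prefixWord φ d (x n)).IsChain (fun x y => y.1 = 1 → y.2 ≠ -x.2) :=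
      (normalForm φ d (x n)).no_cancel
    have := List.isChain_iff_getElem.1 hc i hj
    rwa [hi', hj'] at this⟩

theorem LettersStabilise.eventually_getElem? {φ : A ≃* B} {d : CosetReps A B} {x : ℕ → HNN φ}
    (h : LettersStabilise φ d x) (i : ℕ) :
    ∀ᶠ n in atTop, (prefixWord φ d (x n))[i]? = some (h.limit.1 i) :=
  (h i).choose_spec

theorem LettersStabilise.limit_eq_iff {φ : A ≃* B} {d : CosetReps A B} {x : ℕ → HNN φ}
    (h : LettersStabilise φ d x) (i : ℕ) (s : G₀ × ℤˣ) :
    h.limit.1 i = s ↔ ∀ᶠ n in atTop, (prefixWord φ d (x n))[i]? = some s := by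
  refine ⟨fun hs => hs ▸ h.eventually_getElem? i, fun hs => ?_⟩
  obtain ⟨n, hn, hn'⟩ := (hs.and (h.eventually_getElem? i)).exists
  exact Option.some_injective _ (hn'.symm.trans hn)

theorem LettersStabilise.convergesTo {φ : A ≃* B} {d : CosetReps A B} {x : ℕ → HNN φ}
    (h : LettersStabilise φ d x) : ConvergesTo φ d x h.limit := by
  refine tendsto_atTop.2 fun k => ?_
  have hall : ∀ᶠ n in atTop, ∀ i ∈ Set.Iio k,
      (prefixWord φ d (x n))[i]? = some (h.limit.1 i) :=
    (Set.finite_Iio k).eventually_all.2 fun i _ => h.eventually_getElem? i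
  filter_upwards [hall] with n hn
  refine le_csSup ⟨_, fun i hi => hi.1⟩ ⟨?_, hn⟩
  by_contra! hlt
  have := hn (prefixWord φ d (x n)).length hlt
  simp at this

theorem LettersStabilise.exitTime_lt_top {φ : A ≃* B} {d : CosetReps A B} {x : ℕ → HNN φ}
    (h : LettersStabilise φ d x) (k : ℕ) : exitTime φ d x k < ⊤ := by
  obtain ⟨m, hm⟩ := eventually_atTop.1 (h.eventually_getElem? k)
  refine lt_of_le_of_lt (iInf₂_le m fun n hn => ?_) (ENat.natCast_lt_top m)
  exact (List.getElem?_eq_some_iff.1 (hm n hn)).1.le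

open Classical in
/-- The limit word of a trajectory, with the junk value `t t t ⋯` when the letters do not
stabilise. -/
noncomputable def limitWord (φ : A ≃* B) (d : CosetReps A B) (x : ℕ → HNN φ) : Boundary d :=
  if h : LettersStabilise φ d x then h.limit else Boundary.const d

theorem measurable_limitWord [Countable G₀] {Ω : Type*} [MeasurableSpace Ω] (φ : A ≃* B)
    (d : CosetReps A B) {X : ℕ → Ω → HNN φ} (hX : ∀ n, Measurable (X n)) :
    Measurable fun ω => limitWord φ d fun n => X n ω := by
  have hlim : ∀ (i : ℕ) (s : G₀ × ℤˣ), MeasurableSet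
      {ω | ∀ᶠ n in atTop, (prefixWord φ d (X n ω))[i]? = some s} := by
    intro i s
    have : {ω | ∀ᶠ n in atTop, (prefixWord φ d (X n ω))[i]? = some s} =
        ⋃ m, ⋂ n, ⋂ (_ : m ≤ n), X n ⁻¹' {g | (prefixWord φ d g)[i]? = some s} := by
      ext ω
      simp [eventually_atTop]
    rw [this]
    exact .iUnion fun m => .iInter fun n => .iInter fun _ => hX n .of_discrete
  have hgood : MeasurableSet {ω | LettersStabilise φ d fun n => X n ω} := by
    have : {ω | LettersStabilise φ d fun n => X n ω} =
        ⋂ i : ℕ, ⋃ s, {ω | ∀ᶠ n in atTop, (prefixWord φ d (X n ω))[i]? = some s} := by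
      ext ω
      simp [LettersStabilise]
    rw [this]
    exact .iInter fun i => .iUnion fun s => hlim i s
  refine Measurable.of_le_map (iSup_le fun i => ?_)
  rw [MeasurableSpace.comap_le_iff_le_map]
  rintro T -
  have : (fun ω => limitWord φ d fun n => X n ω) ⁻¹' ((fun w : Boundary d => w.1 i) ⁻¹' T) =
      ({ω | LettersStabilise φ d fun n => X n ω} ∩
        ⋃ s ∈ T, {ω | ∀ᶠ n in atTop, (prefixWord φ d (X n ω))[i]? = some s}) ∪
      ({ω | LettersStabilise φ d fun n => X n ω}ᶜ ∩ {_ω | (Boundary.const d).1 i ∈ T}) := by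
    ext ω
    by_cases h : LettersStabilise φ d fun n => X n ω
    · simp only [Set.mem_preimage, limitWord, h, dite_true, Set.mem_union, Set.mem_inter_iff,
        Set.mem_ofPred_eq, Set.mem_iUnion, ← h.limit_eq_iff, Set.mem_compl_iff, not_true_eq_false,
        false_and, or_false, true_and, exists_prop, exists_eq_right']
    · simp [limitWord, h]
  change MeasurableSet ((fun ω => limitWord φ d fun n => X n ω) ⁻¹' _)
  rw [this]
  exact (hgood.inter (.biUnion (Set.to_countable T) fun s _ => hlim i s)).union
    (hgood.compl.inter (.const _))

end Limit

/-! ### The step distribution -/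

section StepLaw

variable {G₀ : Type*} [Group G₀] {A B : Subgroup G₀}

theorem countable_of_closure_eq_top {M : Type*} [Monoid M] {s : Set M} (hs : s.Countable)
    (h : Subsemigroup.closure s = ⊤) : Countable M := by
  have := hs.to_subtype
  have hsurj : Function.Surjective (FreeMonoid.lift ((↑) : s → M)) := by
    intro g
    have hg : g ∈ Subsemigroup.closure s := h ▸ Subsemigroup.mem_top g
    induction hg using Subsemigroup.closure_induction with
    | mem x hx => exact ⟨FreeMonoid.of ⟨x, hx⟩, by simp⟩
    | mul x y _ _ hx hy =>
      obtain ⟨⟨v, rfl⟩, w, rfl⟩ := And.intro hx hy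
      exact ⟨v * w, map_mul _ v w⟩
  exact hsurj.countable

theorem countable_HNN [Countable G₀] (φ : A ≃* B) (d : CosetReps A B) : Countable (HNN φ) := by
  have hinj : Function.Injective fun w : NormalForm d => (w.letters, w.last) := by
    intro w w' h
    exact NormalForm.ext (congrArg Prod.fst h) (congrArg Prod.snd h)
  have := hinj.countable
  exact (normalForm φ d).injective.countable

theorem ae_isStep (φ : A ≃* B) (μ₀ : PMF G₀) (α p : ℝ) :
    ∀ᵐ s ∂stepLaw φ μ₀ α p, IsStep φ s := by
  have h1 : ∀ᵐ s ∂(μ₀.map (HNNExtension.of : G₀ →* HNN φ)).toMeasure, IsStep φ s := by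
    rw [ae_iff, PMF.toMeasure_apply_eq_zero_iff _ .of_discrete, Set.disjoint_left]
    intro s hs hs'
    obtain ⟨h, -, rfl⟩ := (PMF.mem_support_map_iff _ _ _).1 hs
    exact hs' (Or.inl ⟨h, rfl⟩)
  have h2 : IsStep φ HNNExtension.t := Or.inr ⟨1, by simp⟩
  have h3 : IsStep φ HNNExtension.t⁻¹ := Or.inr ⟨-1, by simp⟩
  rw [ae_iff] at h1
  rw [ae_iff, stepLaw]
  simp [h1, h2, h3]

theorem stepLaw_of_ne_zero (φ : A ≃* B) (μ₀ : PMF G₀) {α : ℝ} (p : ℝ) (hα : 0 < α) {h : G₀}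
    (hh : h ∈ μ₀.support) : stepLaw φ μ₀ α p {HNNExtension.of h} ≠ 0 := by
  have h1 : (μ₀.map (HNNExtension.of : G₀ →* HNN φ)).toMeasure {HNNExtension.of h} ≠ 0 := by
    rw [PMF.toMeasure_apply_singleton _ _ (.singleton _), ← PMF.mem_support_iff,
      PMF.mem_support_map_iff]
    exact ⟨h, hh, rfl⟩
  simp [stepLaw, h1, hα]

theorem stepLaw_t_zpow_ne_zero (φ : A ≃* B) (μ₀ : PMF G₀) {α p : ℝ} (hα : α < 1)
    (hp : p ∈ Set.Ioo (0 : ℝ) 1) (u : ℤˣ) :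
    stepLaw φ μ₀ α p {HNNExtension.t ^ (u : ℤ)} ≠ 0 := by
  rcases Int.units_eq_one_or u with rfl | rfl <;> simp [stepLaw, hα, hp.1, hp.2]

/-- The walk on the HNN extension is irreducible, since `G₀`, `t` and `t⁻¹` generate it. -/
theorem isIrreducible_of_stepLaw (φ : A ≃* B) [Countable (HNN φ)] (μ₀ : PMF G₀)
    (hgen : Subsemigroup.closure μ₀.support = ⊤) {α p : ℝ} (hα : α ∈ Set.Ioo (0 : ℝ) 1)
    (hp : p ∈ Set.Ioo (0 : ℝ) 1) {Ω : Type*} [MeasurableSpace Ω] {P : Measure Ω}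
    {ζ : ℕ → Ω → HNN φ} (h : IsIIDSteps P ζ) (hlaw : P.map (ζ 0) = stepLaw φ μ₀ α p) :
    IsIrreducible P ζ := by
  have hmul : ∀ x y, (∃ n, P {ω | walk ζ n ω = x} ≠ 0) → (∃ n, P {ω | walk ζ n ω = y} ≠ 0) →
      ∃ n, P {ω | walk ζ n ω = x * y} ≠ 0 := by
    rintro x y ⟨m, hm⟩ ⟨n, hn⟩
    exact ⟨m + n, ((pos_iff_ne_zero.2 (mul_ne_zero hm hn)).trans_le
      (h.measure_walk_mul_le m n x y)).ne'⟩
  have hone : ∀ s, stepLaw φ μ₀ α p {s} ≠ 0 → ∃ n, P {ω | walk ζ n ω = s} ≠ 0 := by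
    intro s hs
    rw [← hlaw, Measure.map_apply (h.meas 0) (.singleton s)] at hs
    refine ⟨1, ?_⟩
    simpa [walk] using! hs
  have hof : ∀ g : G₀, ∃ n, P {ω | walk ζ n ω = HNNExtension.of g} ≠ 0 := by
    intro g
    have hg : g ∈ Subsemigroup.closure μ₀.support := hgen ▸ Subsemigroup.mem_top g
    induction hg using Subsemigroup.closure_induction with
    | mem x hx => exact hone _ (stepLaw_of_ne_zero φ μ₀ p hα.1 hx)
    | mul x y _ _ hx hy => rw [map_mul]; exact hmul _ _ hx hy
  have ht := fun u => hone _ (stepLaw_t_zpow_ne_zero φ μ₀ hα.2 hp u)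
  -- Both `x` and `x⁻¹` are carried along, to have closure under inverses.
  intro x
  refine And.left (b := ∃ n, P {ω | walk ζ n ω = x⁻¹} ≠ 0) ?_
  induction x using HNNExtension.induction_on with
  | of g => exact ⟨hof g, by rw [← map_inv]; exact hof g⁻¹⟩
  | t => exact ⟨by simpa using ht 1, by simpa using ht (-1)⟩
  | mul x y hx hy => exact ⟨hmul _ _ hx.1 hy.1, by rw [mul_inv_rev]; exact hmul _ _ hy.2 hx.2⟩
  | inv x hx => exact ⟨hx.2, by rw [inv_inv]; exact hx.1⟩

end StepLaw

end HNNWalk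

theorem proposition3p2 {G₀ : Type*} [Group G₀] {A B : Subgroup G₀} [Finite A] [Finite B]
    (φ : A ≃* B) (d : HNNWalk.CosetReps A B)
    (μ₀ : PMF G₀) (hμ₀_fin : μ₀.support.Finite) (hμ₀_gen : Subsemigroup.closure μ₀.support = ⊤)
    (α p : ℝ) (hα : α ∈ Set.Ioo (0 : ℝ) 1) (hp : p ∈ Set.Ioo (0 : ℝ) 1)
    {Ω : Type*} [MeasurableSpace Ω] (P : Measure Ω) [IsProbabilityMeasure P]
    (ζ : ℕ → Ω → HNNWalk.HNN φ) (hζ_meas : ∀ i, Measurable (ζ i)) (hζ_indep : iIndepFun ζ P)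
    (hζ_law : ∀ i, P.map (ζ i) = HNNWalk.stepLaw φ μ₀ α p)
    (htrans : HNNWalk.IsTransient P (HNNWalk.walk ζ)) :
    (∀ k : ℕ, ∀ᵐ ω ∂P, HNNWalk.exitTime φ d (fun n => HNNWalk.walk ζ n ω) k < ⊤) ∧
      ∃ Xinf : Ω → HNNWalk.Boundary d, Measurable Xinf ∧
        ∀ᵐ ω ∂P, HNNWalk.ConvergesTo φ d (fun n => HNNWalk.walk ζ n ω) (Xinf ω) := by
  have hG₀ : Countable G₀ := HNNWalk.countable_of_closure_eq_top hμ₀_fin.countable hμ₀_gen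
  have hG : Countable (HNNWalk.HNN φ) := HNNWalk.countable_HNN φ d
  have h : HNNWalk.IsIIDSteps P ζ :=
    ⟨hζ_meas, hζ_indep, fun i => (hζ_law i).trans (hζ_law 0).symm⟩
  have hirr := HNNWalk.isIrreducible_of_stepLaw φ μ₀ hμ₀_gen hα hp h (hζ_law 0)
  have hstep : ∀ᵐ ω ∂P, ∀ n, ∃ s, HNNWalk.IsStep φ s ∧
      HNNWalk.walk ζ (n + 1) ω = HNNWalk.walk ζ n ω * s := by
    refine ae_all_iff.2 fun n => ?_
    have := HNNWalk.ae_isStep φ μ₀ α p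
    rw [← hζ_law n] at this
    filter_upwards [ae_of_ae_map (hζ_meas n).aemeasurable this] with ω hω
    exact ⟨ζ n ω, hω, rfl⟩
  have hpoint := h.ae_eventually_walk_ne hirr htrans
  -- The cosets of `G₀` cannot all be visited infinitely often: an edge would be crossed too often.
  have hfin : ∀ᵐ ω ∂P, ∀ g, ∀ᶠ n in atTop,
      g * HNNWalk.walk ζ n ω ∉ (HNNExtension.of : G₀ →* HNNWalk.HNN φ).range := by
    refine (h.ae_frequently_mem_coset hirr _).resolve_right fun hrec => ?_
    obtain ⟨ω, hω, hωs, hωp⟩ := (hrec.and (hstep.and hpoint)).exists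
    obtain ⟨g, hg⟩ := HNNWalk.frequently_mem_of_frequently_cosets φ d
      (x := fun n => HNNWalk.walk ζ n ω) hωs (by simpa using hω 1) (hω _)
    exact hg (hωp g)
  have hconv : ∀ᵐ ω ∂P, HNNWalk.LettersStabilise φ d fun n => HNNWalk.walk ζ n ω := by
    filter_upwards [hstep, hfin] with ω h1 h2
    exact HNNWalk.eventually_getElem?_prefixWord φ d h1 h2
  refine ⟨fun k => hconv.mono fun ω hω => hω.exitTime_lt_top k,
    fun ω => HNNWalk.limitWord φ d fun n => HNNWalk.walk ζ n ω,
    HNNWalk.measurable_limitWord φ d h.measurable_walk, ?_⟩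
  filter_upwards [hconv] with ω hω
  rw [HNNWalk.limitWord, dif_pos hω]
  exact hω.convergesTo
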